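/- \textbf{Proposition (success probability of dual-branch MRC in the no-correlation model).} Let $\alpha>2$, $d>0$, $\lambda>0$, $\mathtt{SNR}>0$, $T>0$, $m_I>0$ be real and let $m_D\ge 1$ be an integer. For each of two antennas (branches) $n\in\{1,2\}$, let the interferer locations $\{\mathsf x_{n,i}\}_{i\ge 0}\subset\mathbb R^2$ form a homogeneous Poisson point process of density $\lambda$, let the gains $(\mathsf h_{n,i})_{i\ge0}$ of the interfering links be i.i.d. Gamma with shape $m_I$ and scale $1/m_I$ and independent of the locations $(\mathsf x_{n,i})_{i\ge0}$, and let $$\mathsf I_n=d^{\alpha}\sum_{i\ge 0}\mathsf h_{n,i}\,\|\mathsf x_{n,i}\|^{-\alpha}$$ be the interference power at antenna $n$. Let the gains $\mathsf g_1,\mathsf g_2$ of the desired links be independent Gamma variables with shape $m_D$ and scale $1/m_D$, with $(\mathsf g_1,\mathsf g_2)$ independent of all interferer locations and gains. Assume (no correlation) that $\mathsf I_1$ and $\mathsf I_2$ are independent. Write $(x)^+=\max\{0,x\}$ and $$\mathcal B(z,s,t)=\Gamma(1-2/\alpha)\,d^2\,\frac{\Gamma(2/\alpha+m_I)}{\Gamma(m_I)}\Big(\frac{m_D}{m_I}\Big)^{2/\alpha}\Big(\big(s\,(T-z)^+\big)^{2/\alpha}+(zt)^{2/\alpha}\Big).$$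 Then $$\mathbb P\Big(\frac{\mathsf g_1}{\mathsf I_1+\mathtt{SNR}^{-1}}+\frac{\mathsf g_2}{\mathsf I_2+\mathtt{SNR}^{-1}}\ge T\Big)=\sum_{k=0}^{m_D-1}\frac{(-1)^{k+m_D}}{k!\,\Gamma(m_D)}\int_0^\infty \frac1z\,\frac{\partial^{k}\,\partial^{m_D}}{\partial s^{k}\,\partial t^{m_D}}\bigg[\exp\Big(-\frac{(T-z)^+\,s\,m_D}{\mathtt{SNR}}-\frac{z\,t\,m_D}{\mathtt{SNR}}-\pi\lambda\,\mathcal B(z,s,t)\Big)\bigg]_{s=t=1}\,dz,$$ where, for every $z>0$, the function of $(s,t)$ in brackets is infinitely differentiable at $(1,1)$, and all the integrals converge absolutely. -/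

import Mathlib

open MeasureTheory ProbabilityTheory Set
open scoped ENNReal NNReal Nat

noncomputable section

/-- The Euclidean plane. -/
abbrev Plane : Type := EuclideanSpace ℝ (Fin 2)

/-- The number (with multiplicity) of points of the random sequence `X` that lie in `B`. -/
def pointCount {Ω : Type*} (X : ℕ → Ω → Plane) (B : Set Plane) (ω : Ω) : ℝ≥0∞ :=
  ∑' i, B.indicator (fun _ => (1 : ℝ≥0∞)) (X i ω)

/-- The random points `X 0, X 1, …` enumerate a stationary (homogeneous) Poisson point process
of density `lam` on the plane: the number of points in a Borel set `B` of finite area `|B|` is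
Poisson distributed with mean `lam * |B|`, and the numbers of points in pairwise disjoint Borel
sets of finite area are independent. -/
structure IsPoissonPointProcess {Ω : Type*} [MeasurableSpace Ω] (μ : Measure Ω) (lam : ℝ)
    (X : ℕ → Ω → Plane) : Prop where
  measurable : ∀ i, Measurable (X i)
  count_law : ∀ B : Set Plane, MeasurableSet B → volume B ≠ ∞ →
    HasLaw (pointCount X B)
      ((poissonMeasure (Real.toNNReal (lam * volume.real B))).map (Nat.cast : ℕ → ℝ≥0∞)) μ
  count_indep : ∀ (n : ℕ) (B : Fin n → Set Plane), (∀ j, MeasurableSet (B j)) →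
    (∀ j, volume (B j) ≠ ∞) → Pairwise (fun i j => Disjoint (B i) (B j)) →
    iIndepFun (fun j => pointCount X (B j)) μ

/-- The law of a Nakagami-`m` power fading gain: the Gamma law with shape `m` and scale `1 / m`,
i.e. with density `m ^ m * y ^ (m - 1) / Γ(m) * exp (-m * y)` on `y ≥ 0`. -/
def nakagamiGainLaw (m : ℝ) : Measure ℝ := gammaMeasure m m

/-- The interference power `d ^ α * ∑ i, h i * ‖x i‖ ^ (-α)` at one antenna (placed at the
origin), for interferer locations `x i` and fading gains `h i`; its value may be `∞`. -/
def interference (α d : ℝ) (x : ℕ → Plane) (h : ℕ → ℝ) : ℝ≥0∞ :=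
  ENNReal.ofReal d ^ α * ∑' i, ENNReal.ofReal (h i) * ‖x i‖ₑ ^ (-α)

/-- The post-combiner SINR `∑ n, g n / (I n + 1 / SNR)` of maximal-ratio combining. -/
def sinrMRC {N : ℕ} (SNR : ℝ) (g : Fin N → ℝ) (I : Fin N → ℝ≥0∞) : ℝ≥0∞ :=
  ∑ n, ENNReal.ofReal (g n) / (I n + (ENNReal.ofReal SNR)⁻¹)

/-- The no-correlation model with `N` branches. `g n` is the gain of the desired link to antenna
`n`; `X n i` and `h n i` are the locations of the interferers seen by antenna `n` and the gains of
the corresponding interfering links. -/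
structure IsNCModel {Ω : Type*} [MeasurableSpace Ω] (μ : Measure Ω) {N : ℕ}
    (α d lam mD mI : ℝ) (g : Fin N → Ω → ℝ) (X : Fin N → ℕ → Ω → Plane)
    (h : Fin N → ℕ → Ω → ℝ) : Prop where
  measurable_g : ∀ n, Measurable (g n)
  measurable_h : ∀ n i, Measurable (h n i)
  /-- The interferers seen by each antenna form a Poisson point process of density `lam`. -/
  poisson : ∀ n, IsPoissonPointProcess μ lam (X n)
  /-- Desired links: independent Nakagami-`mD` fading. -/
  law_g : ∀ n, HasLaw (g n) (nakagamiGainLaw mD) μ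
  indep_g : iIndepFun g μ
  /-- Interfering links: Nakagami-`mI` fading, independent across the interferers and of
  their locations. -/
  law_h : ∀ n i, HasLaw (h n i) (nakagamiGainLaw mI) μ
  indep_h : ∀ n, iIndepFun (h n) μ
  indep_X_h : ∀ n, IndepFun (fun ω i => X n i ω) (fun ω i => h n i ω) μ
  /-- The gains of the desired links are independent of all interferer locations and gains. -/
  indep_g_field : IndepFun (fun ω n => g n ω)
    (fun ω => ((fun n i => X n i ω : Fin N → ℕ → Plane), (fun n i => h n i ω : Fin N → ℕ → ℝ))) μ
  /-- No correlation: the interference powers at different branches are independent. -/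
  indep_I : Pairwise fun m n => IndepFun
    (fun ω => interference α d (fun i => X m i ω) (fun i => h m i ω))
    (fun ω => interference α d (fun i => X n i ω) (fun i => h n i ω)) μ

/-- The success probability `P(SINR ≥ T)` of maximal-ratio combining. -/
def successProbMRC {Ω : Type*} [MeasurableSpace Ω] (μ : Measure Ω) {N : ℕ} (α d SNR T : ℝ)
    (g : Fin N → Ω → ℝ) (X : Fin N → ℕ → Ω → Plane) (h : Fin N → ℕ → Ω → ℝ) : ℝ :=
  μ.real {ω | ENNReal.ofReal T ≤
    sinrMRC SNR (fun n => g n ω) (fun n => interference α d (fun i => X n i ω) (fun i => h n i ω))}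

/-- The function `exp (-(T-z)⁺ s mD / SNR - z t mD / SNR - π lam A(z,s,t))`. -/
def mrcExp (mD : ℕ) (SNR T lam : ℝ) (A : ℝ → ℝ → ℝ → ℝ) (z s t : ℝ) : ℝ :=
  Real.exp (-(max 0 (T - z) * s * mD / SNR) - z * t * mD / SNR - Real.pi * lam * A z s t)

/-- The integrand `z⁻¹ ∂ᵏ/∂sᵏ ∂^mD/∂t^mD [mrcExp]` at `s = t = 1`. -/
def mrcIntegrand (mD : ℕ) (SNR T lam : ℝ) (A : ℝ → ℝ → ℝ → ℝ) (k : ℕ) (z : ℝ) : ℝ :=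
  z⁻¹ * iteratedDeriv k
    (fun s => iteratedDeriv mD (fun t => mrcExp mD SNR T lam A z s t) 1) 1

/-- The dual-branch formula
`∑_{k < mD} (-1)^(k+mD) / (k! Γ(mD)) ∫_0^∞ z⁻¹ ∂ᵏ/∂sᵏ ∂^mD/∂t^mD [mrcExp]_{s=t=1} dz`. -/
def mrcFormula (mD : ℕ) (SNR T lam : ℝ) (A : ℝ → ℝ → ℝ → ℝ) : ℝ :=
  ∑ k ∈ Finset.range mD, (-1 : ℝ) ^ (k + mD) / ((k ! : ℝ) * Real.Gamma mD) *
    ∫ z in Ioi (0 : ℝ), mrcIntegrand mD SNR T lam A k z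

/-- The function `ℬ(z,s,t)` of the no-correlation model. -/
def ncB (α d mI T : ℝ) (mD : ℕ) (z s t : ℝ) : ℝ :=
  Real.Gamma (1 - 2 / α) * d ^ 2 * (Real.Gamma (2 / α + mI) / Real.Gamma mI) *
    ((mD : ℝ) / mI) ^ (2 / α) * ((s * max 0 (T - z)) ^ (2 / α) + (z * t) ^ (2 / α))

end

/-! Put `Y n = I n + 1/SNR` and condition on both `Y n`. Then `g 1 / Y 1` is Erlang with rate `mD *
Y 1`, and the event says that `g 0 / Y 0` is at least `T - z`, where `z` is the value of `g 1 / Y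
1`. The Erlang density at `z` and each of the `mD` terms of the Erlang tail at `T - z` are a power
of `Y n` times an exponential in `Y n`. Up to signs and constants they are derivatives at `1` of `t
↦ exp (-mD z t Y 1)` and `s ↦ exp (-mD (T-z)⁺ s Y 0)`. Averaging turns these into derivatives of
Laplace transforms, and independence of the two interferences makes the average a product
(`measure_le_div_add_div`, `measureReal_le_div_add_div`).

The Laplace transform of `I n` is that of a marked Poisson process (`lintegral_negExp_tsum_mark`).
The power law makes it `exp (-π λ K θ^(2/α))`, where the moment of order `2/α` of the Gamma marks
enters `K` (`lintegral_negExp_interference`).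

With its sign each term is nonnegative. Tonelli therefore applies in `[0, ∞]`, and absolute
convergence follows because the total is a probability. -/

/-! ### Laplace transforms with values in `[0, ∞]` -/

/-- The function `x ↦ exp (-x)` on `[0, ∞]`, with value `0` at `∞`. -/
noncomputable def negExp (x : ℝ≥0∞) : ℝ≥0∞ := EReal.exp (-(x : EReal))

@[simp] lemma negExp_zero : negExp 0 = 1 := by simp [negExp]

@[simp] lemma negExp_top : negExp ∞ = 0 := by simp [negExp]

lemma negExp_add (x y : ℝ≥0∞) : negExp (x + y) = negExp x * negExp y := by
  rw [negExp, EReal.coe_ennreal_add, EReal.neg_add (by simp) (by simp), sub_eq_add_neg,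
    EReal.exp_add, negExp, negExp]

lemma negExp_ofReal {x : ℝ} (hx : 0 ≤ x) :
    negExp (ENNReal.ofReal x) = ENNReal.ofReal (Real.exp (-x)) := by
  rw [negExp, EReal.coe_ennreal_ofReal, max_eq_left hx, ← EReal.coe_neg, EReal.exp_coe]

lemma negExp_sum {ι : Type*} (s : Finset ι) (f : ι → ℝ≥0∞) :
    negExp (∑ i ∈ s, f i) = ∏ i ∈ s, negExp (f i) := by
  classical
  induction s using Finset.induction_on with
  | empty => simp
  | insert i s hi ih => rw [Finset.sum_insert hi, Finset.prod_insert hi, negExp_add, ih]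

lemma negExp_mul_natCast (c : ℝ≥0∞) (n : ℕ) : negExp (c * n) = negExp c ^ n := by
  have := negExp_sum (Finset.range n) (fun _ => c)
  simpa [mul_comm] using this

lemma negExp_antitone : Antitone negExp := fun x y h =>
  EReal.exp_monotone (EReal.neg_le_neg_iff.2 (by exact_mod_cast h))

lemma negExp_le_one (x : ℝ≥0∞) : negExp x ≤ 1 := by
  simpa using negExp_antitone (zero_le (a := x))

lemma negExp_ne_top (x : ℝ≥0∞) : negExp x ≠ ∞ := ne_top_of_le_ne_top (by simp) (negExp_le_one x)

lemma continuous_negExp : Continuous negExp :=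
  ENNReal.continuous_exp.comp (continuous_neg.comp continuous_coe_ennreal_ereal)

@[fun_prop] lemma measurable_negExp : Measurable negExp := continuous_negExp.measurable

/-- Used to absorb the average over a mark into a deterministic function of the location; `y = 0` is
allowed because the exponent may be `∞`. -/
lemma exists_negExp_eq {y : ℝ≥0∞} (hy : y ≤ 1) : negExp (-(ENNReal.log y)).toENNReal = y := by
  rw [negExp, EReal.coe_toENNReal, neg_neg, ENNReal.exp_log]
  simpa using hy

/-- The Poisson generating function `E[q^N] = exp (-r (1 - q))` at `q = exp (-c)`. The case `c = ∞`
is the probability of no point. -/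
lemma lintegral_negExp_map_poissonMeasure (r : ℝ≥0) (c : ℝ≥0∞) :
    ∫⁻ x, negExp (c * x) ∂((poissonMeasure r).map (Nat.cast : ℕ → ℝ≥0∞)) =
      negExp (r * (1 - negExp c)) := by
  obtain ⟨q, hq0, hq1, hq⟩ : ∃ q : ℝ, 0 ≤ q ∧ q ≤ 1 ∧ negExp c = ENNReal.ofReal q := by
    refine ⟨(negExp c).toReal, by simp, ?_, (ENNReal.ofReal_toReal (negExp_ne_top c)).symm⟩
    simpa using ENNReal.toReal_mono (by simp) (negExp_le_one c)
  rw [lintegral_map (by fun_prop) (by fun_prop), poissonMeasure, lintegral_sum_measure]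
  have hS : HasSum (fun n : ℕ => Real.exp (-r) * ((r * q) ^ n / n !))
      (Real.exp (-r) * Real.exp (r * q)) := by
    rw [Real.exp_eq_exp_ℝ]
    exact (NormedSpace.expSeries_div_hasSum_exp (r * q : ℝ)).mul_left _
  have : ∀ n : ℕ, ∫⁻ a, negExp (c * (a : ℝ≥0∞)) ∂(ENNReal.ofReal (Real.exp (-r) * r ^ n / n !) •
      Measure.dirac n) = ENNReal.ofReal (Real.exp (-r) * ((r * q) ^ n / n !)) := by
    intro n
    rw [lintegral_smul_measure, lintegral_dirac, negExp_mul_natCast, hq, smul_eq_mul,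
      ← ENNReal.ofReal_pow hq0, ← ENNReal.ofReal_mul (by positivity)]
    congr 1
    ring
  rw [tsum_congr this, ← ENNReal.ofReal_tsum_of_nonneg (fun n => by positivity) hS.summable,
    hS.tsum_eq, hq, ← ENNReal.ofReal_one, ← ENNReal.ofReal_sub _ hq0, ← ENNReal.ofReal_coe_nnreal,
    ← ENNReal.ofReal_mul (by positivity), negExp_ofReal (mul_nonneg (by positivity) (by linarith)),
    ← Real.exp_add]
  congr 2
  ring

lemma tsum_iSup_of_monotone {f : ℕ → ℕ → ℝ≥0∞} (hf : ∀ i, Monotone fun n => f n i) :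
    ∑' i, ⨆ n, f n i = ⨆ n, ∑' i, f n i := by
  simp_rw [← lintegral_count]
  exact lintegral_iSup (fun n => measurable_of_countable _) fun _ _ h i => hf i h

/-! ### Laplace functionals of Poisson processes -/

section
variable {Ω : Type*} [MeasurableSpace Ω] {μ : Measure Ω}

lemma lintegral_negExp_pointCount {lam : ℝ} {X : ℕ → Ω → Plane}
    (hX : IsPoissonPointProcess μ lam X) (hlam : 0 ≤ lam) {B : Set Plane} (hB : MeasurableSet B)
    (hvol : volume B ≠ ∞) (c : ℝ≥0∞) :
    ∫⁻ ω, negExp (c * pointCount X B ω) ∂μ =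
      negExp (ENNReal.ofReal lam * volume B * (1 - negExp c)) := by
  have := (hX.count_law B hB hvol).lintegral_comp (f := fun x => negExp (c * x)) (by fun_prop)
  rw [this, lintegral_negExp_map_poissonMeasure]
  congr 2
  rw [← ENNReal.ofReal, ENNReal.ofReal_mul hlam, measureReal_def, ENNReal.ofReal_toReal hvol]

lemma measurable_pointCount {X : ℕ → Ω → Plane} (hX : ∀ i, Measurable (X i)) {B : Set Plane}
    (hB : MeasurableSet B) : Measurable (pointCount X B) :=
  Measurable.tsum fun i => (measurable_const.indicator hB).comp (hX i)

/-- The Laplace functional of a Poisson point process at a simple function. -/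
lemma lintegral_negExp_tsum_simpleFunc {lam : ℝ} {X : ℕ → Ω → Plane}
    (hX : IsPoissonPointProcess μ lam X) (hlam : 0 ≤ lam) (f : SimpleFunc Plane ℝ≥0∞)
    (hf : volume (Function.support f) ≠ ∞) :
    ∫⁻ ω, negExp (∑' i, f (X i ω)) ∂μ =
      negExp (ENNReal.ofReal lam * ∫⁻ x, (1 - negExp (f x))) := by
  classical
  set s := f.range.filter (· ≠ 0)
  set e := s.equivFin.symm
  let B : Fin s.card → Set Plane := fun j => f ⁻¹' {(e j : ℝ≥0∞)}
  have hBm : ∀ j, MeasurableSet (B j) := fun j => f.measurableSet_preimage _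
  have he0 : ∀ j, (e j : ℝ≥0∞) ≠ 0 := fun j => (Finset.mem_filter.1 (e j).2).2
  have hBv : ∀ j, volume (B j) ≠ ∞ := fun j =>
    measure_ne_top_of_subset (fun x hx => by
      have : f x = e j := hx
      simpa [this] using he0 j) hf
  have hdisj : Pairwise fun i j => Disjoint (B i) (B j) := fun i j hij => by
    refine Disjoint.preimage _ (disjoint_singleton.2 fun h => hij (e.injective (Subtype.ext h)))
  -- The decomposition over nonzero level sets serves twice: `u = id` expresses the sum over points
  -- through independent counts, and `u = 1 - negExp` computes the integral. The level `0`, possibly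
  -- of infinite area, drops out since `u 0 = 0`.
  have key : ∀ u : ℝ≥0∞ → ℝ≥0∞, u 0 = 0 → ∀ x,
      u (f x) = ∑ j, u (e j) * (B j).indicator (fun _ => 1) x := by
    intro u h0 x
    by_cases hx : f x = 0
    · rw [hx, h0, Finset.sum_eq_zero]
      intro j _
      rw [indicator_of_notMem, mul_zero]
      exact fun h => he0 j (by rw [← hx]; exact (show f x = e j from h).symm)
    · obtain ⟨j, hj⟩ := e.surjective ⟨f x, Finset.mem_filter.2 ⟨f.mem_range_self x, hx⟩⟩
      have hj' : (e j : ℝ≥0∞) = f x := by rw [hj]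
      rw [Finset.sum_eq_single j]
      · rw [hj', indicator_of_mem (show x ∈ B j from hj'.symm), mul_one]
      · intro i _ hij
        rw [indicator_of_notMem, mul_zero]
        exact fun h => disjoint_left.1 (hdisj hij) h hj'.symm
      · simp
  have hsum : ∀ ω, ∑' i, f (X i ω) = ∑ j, (e j : ℝ≥0∞) * pointCount X (B j) ω := by
    intro ω
    refine (tsum_congr fun i => key (fun y => y) rfl (X i ω)).trans ?_
    rw [Summable.tsum_finsetSum fun _ _ => ENNReal.summable]
    simp_rw [ENNReal.tsum_mul_left, pointCount]
  simp_rw [hsum, negExp_sum]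
  have hind := (hX.count_indep _ B hBm hBv hdisj).comp (fun j x => negExp ((e j : ℝ≥0∞) * x))
    (fun j => by fun_prop)
  have hprod := lintegral_prod_eq_prod_lintegral_of_indepFun Finset.univ _ hind (fun j =>
    Measurable.comp (by fun_prop) (measurable_pointCount hX.measurable (hBm j)))
  simp only [Function.comp_def] at hprod
  rw [hprod]
  simp_rw [lintegral_negExp_pointCount hX hlam (hBm _) (hBv _), ← negExp_sum]
  congr 1
  rw [lintegral_congr fun x => key (fun y => 1 - negExp y) (by simp) x,
    lintegral_finsetSum _ fun j _ => (measurable_const.indicator (hBm j)).const_mul _,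
    Finset.mul_sum]
  refine Finset.sum_congr rfl fun j _ => ?_
  rw [lintegral_const_mul _ (measurable_const.indicator (hBm j)), lintegral_indicator_const (hBm j)]
  ring

/-- The Laplace functional of a Poisson point process. -/
lemma lintegral_negExp_tsum [IsProbabilityMeasure μ] {lam : ℝ} {X : ℕ → Ω → Plane}
    (hX : IsPoissonPointProcess μ lam X) (hlam : 0 ≤ lam) {v : Plane → ℝ≥0∞} (hv : Measurable v) :
    ∫⁻ ω, negExp (∑' i, v (X i ω)) ∂μ =
      negExp (ENNReal.ofReal lam * ∫⁻ x, (1 - negExp (v x))) := by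
  -- Simple approximations are cut off to balls so that their supports have finite area, as the
  -- count laws require.
  let f : ℕ → SimpleFunc Plane ℝ≥0∞ := fun n =>
    (SimpleFunc.eapprox v n).restrict (Metric.ball 0 n)
  have hfa : ∀ n x, f n x = (Metric.ball (0 : Plane) n).indicator (SimpleFunc.eapprox v n) x :=
    fun n x => SimpleFunc.restrict_apply _ measurableSet_ball _
  have hmono : ∀ x, Monotone fun n => f n x := by
    intro x m n hmn
    simp only [hfa]
    refine (indicator_le_indicator_of_subset (Metric.ball_subset_ball (Nat.cast_le.2 hmn))
      (fun _ => zero_le) x).trans ?_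
    exact indicator_le_indicator (SimpleFunc.monotone_eapprox v hmn x)
  have hsup : ∀ x, ⨆ n, f n x = v x := by
    intro x
    refine le_antisymm (iSup_le fun n => ?_) ?_
    · rw [hfa]
      refine (indicator_le_self' (fun _ _ => zero_le) x).trans ?_
      rw [← SimpleFunc.iSup_eapprox_apply hv x]
      exact le_iSup (fun n => SimpleFunc.eapprox v n x) n
    · rw [← SimpleFunc.iSup_eapprox_apply hv x]
      refine iSup_le fun n => ?_
      obtain ⟨N, hN⟩ := exists_nat_gt ‖x‖
      refine le_trans ?_ (le_iSup (fun n => f n x) (max n N))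
      rw [hfa, indicator_of_mem]
      · exact SimpleFunc.monotone_eapprox v (le_max_left _ _) x
      · rw [mem_ball_zero_iff]
        exact hN.trans_le (by exact_mod_cast le_max_right _ _)
  have hsupp : ∀ n, volume (Function.support (f n)) ≠ ∞ := fun n =>
    measure_ne_top_of_subset (fun x hx => by
      by_contra h
      exact hx (by rw [hfa, indicator_of_notMem h])) (measure_ball_lt_top (x := (0 : Plane))
        (r := n)).ne
  have hL : Filter.Tendsto (fun n => ∫⁻ ω, negExp (∑' i, f n (X i ω)) ∂μ) Filter.atTop
      (nhds (∫⁻ ω, negExp (∑' i, v (X i ω)) ∂μ)) := by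
    refine tendsto_lintegral_of_dominated_convergence (fun _ => 1) (fun n => ?_)
      (fun n => ae_of_all _ fun ω => negExp_le_one _) (by simp) (ae_of_all _ fun ω => ?_)
    · exact measurable_negExp.comp
        (Measurable.tsum fun i => (f n).measurable.comp (hX.measurable i))
    · refine (continuous_negExp.tendsto _).comp ?_
      simp_rw [← hsup]
      rw [tsum_iSup_of_monotone fun i => hmono _]
      exact tendsto_atTop_iSup fun m n hmn => ENNReal.tsum_le_tsum fun i => hmono _ hmn
  -- Monotone convergence is used here, since the constant `1` that dominates on the probability
  -- space is not integrable over the plane.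
  have hR : Filter.Tendsto (fun n => negExp (ENNReal.ofReal lam * ∫⁻ x, (1 - negExp (f n x))))
      Filter.atTop (nhds (negExp (ENNReal.ofReal lam * ∫⁻ x, (1 - negExp (v x))))) := by
    refine (continuous_negExp.tendsto _).comp
      (ENNReal.Tendsto.const_mul ?_ (Or.inr ENNReal.ofReal_ne_top))
    refine lintegral_tendsto_of_tendsto_of_monotone
      (fun n => (measurable_const.sub (by fun_prop)).aemeasurable)
      (ae_of_all _ fun x m n hmn => tsub_le_tsub_left (negExp_antitone (hmono x hmn)) _)
      (ae_of_all _ fun x => ?_)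
    refine ENNReal.Tendsto.sub tendsto_const_nhds ((continuous_negExp.tendsto _).comp ?_)
      (Or.inl ENNReal.one_ne_top)
    rw [← hsup x]
    exact tendsto_atTop_iSup (hmono x)
  refine tendsto_nhds_unique hL ?_
  simpa only [lintegral_negExp_tsum_simpleFunc hX hlam (f _) (hsupp _)] using hR

end

section
variable {Ω : Type*} [MeasurableSpace Ω] {μ : Measure Ω}

lemma lintegral_comp_of_indepFun [IsProbabilityMeasure μ] {E F : Type*} [MeasurableSpace E]
    [MeasurableSpace F] {f : Ω → E} {g : Ω → F} (hf : Measurable f) (hg : Measurable g)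
    (h : IndepFun f g μ) {H : E → F → ℝ≥0∞} (hH : Measurable (Function.uncurry H)) :
    ∫⁻ ω, H (f ω) (g ω) ∂μ = ∫⁻ ω, ∫⁻ ω', H (f ω) (g ω') ∂μ ∂μ := by
  have := (indepFun_iff_map_prod_eq_prod_map_map hf.aemeasurable hg.aemeasurable).1 h
  have := Measure.isProbabilityMeasure_map (μ := μ) hg.aemeasurable
  calc ∫⁻ ω, H (f ω) (g ω) ∂μ
      = ∫⁻ p, Function.uncurry H p ∂(μ.map fun ω => (f ω, g ω)) := by
        rw [lintegral_map hH (hf.prodMk hg)]; rfl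
    _ = ∫⁻ a, ∫⁻ b, H a b ∂(μ.map g) ∂(μ.map f) := by
        rw [‹μ.map _ = _›, lintegral_prod _ hH.aemeasurable]; rfl
    _ = _ := by
        rw [lintegral_map (f := fun a => ∫⁻ b, H a b ∂(μ.map g)) hH.lintegral_prod_right' hf]
        refine lintegral_congr fun ω => ?_
        rw [lintegral_map (hH.of_uncurry_left) hg]

/-- The Laplace functional of an independently marked Poisson point process. -/
lemma lintegral_negExp_tsum_mark [IsProbabilityMeasure μ] {lam : ℝ} {X : ℕ → Ω → Plane}
    (hX : IsPoissonPointProcess μ lam X) (hlam : 0 ≤ lam) {h : ℕ → Ω → ℝ} {γ : Measure ℝ}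
    [IsProbabilityMeasure γ] (hh : ∀ i, Measurable (h i)) (hlaw : ∀ i, HasLaw (h i) γ μ)
    (hind : iIndepFun h μ) (hXh : IndepFun (fun ω i => X i ω) (fun ω i => h i ω) μ)
    {r : Plane → ℝ≥0∞} (hr : Measurable r) :
    ∫⁻ ω, negExp (∑' i, ENNReal.ofReal (h i ω) * r (X i ω)) ∂μ =
      negExp (ENNReal.ofReal lam * ∫⁻ x, ∫⁻ y, (1 - negExp (ENNReal.ofReal y * r x)) ∂γ) := by
  set L : Plane → ℝ≥0∞ := fun x => ∫⁻ y, negExp (ENNReal.ofReal y * r x) ∂γ with hL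
  have hLm : Measurable L := by
    refine Measurable.lintegral_prod_right' (f := fun p : Plane × ℝ =>
      negExp (ENNReal.ofReal p.2 * r p.1)) (by fun_prop)
  have hL1 : ∀ x, L x ≤ 1 := fun x => (lintegral_mono fun y => negExp_le_one _).trans (by simp)
  -- Marks enter only through their average `L`, so the marked sum has the same transform as the
  -- unmarked sum of `v = -log L`.
  set v : Plane → ℝ≥0∞ := fun x => (-(ENNReal.log (L x))).toENNReal with hv
  have hvL : ∀ x, negExp (v x) = L x := fun x => exists_negExp_eq (hL1 x)
  have hvm : Measurable v := by fun_prop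
  have hXm := hX.measurable
  -- With the locations frozen, independence of the marks factors the finite product; the infinite
  -- sum is reached afterwards by dominated convergence.
  have hfin : ∀ n : ℕ, ∫⁻ ω, negExp (∑ i ∈ Finset.range n, ENNReal.ofReal (h i ω) * r (X i ω)) ∂μ =
      ∫⁻ ω, negExp (∑ i ∈ Finset.range n, v (X i ω)) ∂μ := by
    intro n
    have hm : Measurable (Function.uncurry fun (ξ : ℕ → Plane) (η : ℕ → ℝ) =>
        negExp (∑ i ∈ Finset.range n, ENNReal.ofReal (η i) * r (ξ i))) := by
      unfold Function.uncurry
      fun_prop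
    rw [lintegral_comp_of_indepFun (measurable_pi_lambda _ hXm) (measurable_pi_lambda _ hh) hXh hm]
    refine lintegral_congr fun ω => ?_
    simp_rw [negExp_sum, hvL]
    have hi := hind.comp (fun i y => negExp (ENNReal.ofReal y * r (X i ω)))
      (fun i => by fun_prop)
    have := lintegral_prod_eq_prod_lintegral_of_indepFun (Finset.range n) _ hi
      (fun i => Measurable.comp (by fun_prop) (hh i))
    simp only [Function.comp_def] at this
    rw [this]
    refine Finset.prod_congr rfl fun i _ => ?_
    exact (hlaw i).lintegral_comp (f := fun y => negExp (ENNReal.ofReal y * r (X i ω)))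
      (by fun_prop)
  have hlim : ∀ f : ℕ → Ω → ℝ≥0∞, (∀ i, Measurable (f i)) → Filter.Tendsto
      (fun n => ∫⁻ ω, negExp (∑ i ∈ Finset.range n, f i ω) ∂μ) Filter.atTop
      (nhds (∫⁻ ω, negExp (∑' i, f i ω) ∂μ)) := by
    intro f hf
    refine tendsto_lintegral_of_dominated_convergence (fun _ => 1) (fun n => by fun_prop)
      (fun n => ae_of_all _ fun ω => negExp_le_one _) (by simp) (ae_of_all _ fun ω => ?_)
    exact (continuous_negExp.tendsto _).comp (ENNReal.tendsto_nat_tsum _)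
  have h1 := hlim (fun i ω => ENNReal.ofReal (h i ω) * r (X i ω)) (fun i => by fun_prop)
  have h2 := hlim (fun i ω => v (X i ω)) (fun i => by fun_prop)
  simp only [hfin] at h1
  rw [tendsto_nhds_unique h1 h2, lintegral_negExp_tsum hX hlam hvm]
  congr 2
  refine lintegral_congr fun x => ?_
  rw [hvL, lintegral_sub (by fun_prop) (ne_top_of_le_ne_top ENNReal.one_ne_top (hL1 x))
    (ae_of_all _ fun y => negExp_le_one _)]
  simp [hL]

end

/-! ### The radial path-loss integral -/

/-- Layer-cake form of `1 - exp (-z) = ∫_0^z exp (-u) du`, valid also at `z = ∞`. -/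
lemma one_sub_negExp_eq_lintegral (z : ℝ≥0∞) :
    1 - negExp z = ∫⁻ u in Ioi (0 : ℝ),
      {u : ℝ | ENNReal.ofReal u < z}.indicator (fun u => ENNReal.ofReal (Real.exp (-u))) u := by
  have hm : MeasurableSet {u : ℝ | ENNReal.ofReal u < z} :=
    measurableSet_lt ENNReal.measurable_ofReal measurable_const
  have hint : ∀ w : ℝ, ∫⁻ u in Ioi w, ENNReal.ofReal (Real.exp (-u)) =
      ENNReal.ofReal (Real.exp (-w)) := fun w => by
    rw [← ofReal_integral_eq_lintegral_ofReal (exp_neg_integrableOn_Ioi w zero_lt_one |>.congr_fun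
      (fun x _ => by simp) measurableSet_Ioi)
      (ae_of_all _ fun x => (Real.exp_pos _).le), integral_exp_neg_Ioi]
  induction z with
  | top => simpa using (hint 0).symm
  | coe w =>
    rw [lintegral_indicator hm, Measure.restrict_restrict hm]
    have hset : {u : ℝ | ENNReal.ofReal u < w} ∩ Ioi 0 = Ioi 0 \ Ici (w : ℝ) := by
      ext u
      simp only [mem_inter_iff, mem_ofPred_eq, mem_Ioi, mem_sdiff, mem_Ici, not_le]
      rw [← ENNReal.ofReal_coe_nnreal]
      constructor
      · rintro ⟨h1, h2⟩
        exact ⟨h2, (ENNReal.ofReal_lt_ofReal_iff_of_nonneg h2.le).1 h1⟩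
      · rintro ⟨h1, h2⟩
        exact ⟨(ENNReal.ofReal_lt_ofReal_iff_of_nonneg h1.le).2 h2, h1⟩
    have hcompl : ∫⁻ u in Ioi 0, ENNReal.ofReal (Real.exp (-u)) =
        (∫⁻ u in Ioi 0 \ Ici (w : ℝ), ENNReal.ofReal (Real.exp (-u))) +
          ∫⁻ u in Ioi (w : ℝ), ENNReal.ofReal (Real.exp (-u)) := by
      rw [← lintegral_inter_add_sdiff _ (Ioi (0 : ℝ)) (measurableSet_Ici (a := (w : ℝ))), add_comm]
      congr 1
      refine setLIntegral_congr ?_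
      have h := (Filter.EventuallyEq.refl (ae volume) (Ioi (0 : ℝ))).inter
        (Ioi_ae_eq_Ici (μ := volume) (a := (w : ℝ))).symm
      rwa [inter_eq_self_of_subset_right (Ioi_subset_Ioi w.coe_nonneg)] at h
    rw [hint, hint] at hcompl
    rw [hset, ← ENNReal.ofReal_coe_nnreal, negExp_ofReal w.coe_nonneg]
    refine ENNReal.sub_eq_of_eq_add ENNReal.ofReal_ne_top ?_
    rw [← hcompl]
    simp

/-- By the layer-cake form and Tonelli, `exp (-u)` is integrated against the area of the disc where
`k ‖x‖^(-α) > u`, namely `π (k/u)^(2/α)`. This is a Gamma integral, convergent at `0` exactly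
because `α > 2`. -/
lemma lintegral_one_sub_negExp_norm_rpow {α k : ℝ} (hα : 2 < α) (hk : 0 < k) :
    ∫⁻ x : Plane, (1 - negExp (ENNReal.ofReal k * ‖x‖ₑ ^ (-α))) =
      ENNReal.ofReal (Real.pi * Real.Gamma (1 - 2 / α) * k ^ (2 / α)) := by
  have hα0 : 0 < α := by linarith
  have hball : ∀ u ∈ Ioi (0 : ℝ), {x : Plane | ENNReal.ofReal u < ENNReal.ofReal k * ‖x‖ₑ ^ (-α)} =
      Metric.ball 0 ((k / u) ^ α⁻¹) := by
    intro u (hu : 0 < u)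
    ext x
    rw [mem_ofPred_eq, mem_ball_zero_iff]
    rcases eq_or_ne x 0 with rfl | hx
    · have : ENNReal.ofReal k * ‖(0 : Plane)‖ₑ ^ (-α) = ∞ := by
        rw [enorm_zero, ENNReal.zero_rpow_of_neg (by linarith), ENNReal.mul_top]
        simpa using hk
      simp only [this, norm_zero, ENNReal.ofReal_lt_top, true_iff]
      positivity
    · have hx' : 0 < ‖x‖ := norm_pos_iff.2 hx
      rw [← ofReal_norm, ENNReal.ofReal_rpow_of_pos hx', ← ENNReal.ofReal_mul hk.le,
        ENNReal.ofReal_lt_ofReal_iff (by positivity), Real.rpow_neg hx'.le, ← div_eq_mul_inv,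
        lt_div_iff₀ (by positivity), ← lt_div_iff₀' hu,
        Real.lt_rpow_inv_iff_of_pos hx'.le (by positivity) hα0]
  have hmeas : Measurable (Function.uncurry fun (x : Plane) (u : ℝ) =>
      {u : ℝ | ENNReal.ofReal u < ENNReal.ofReal k * ‖x‖ₑ ^ (-α)}.indicator
        (fun u => ENNReal.ofReal (Real.exp (-u))) u) := by
    refine Measurable.indicator (s := {p : Plane × ℝ |
      ENNReal.ofReal p.2 < ENNReal.ofReal k * ‖p.1‖ₑ ^ (-α)})
      (f := fun p => ENNReal.ofReal (Real.exp (-p.2))) (by fun_prop) ?_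
    exact measurableSet_lt (by fun_prop) (by fun_prop)
  simp_rw [one_sub_negExp_eq_lintegral]
  rw [lintegral_lintegral_swap hmeas.aemeasurable]
  have hinner : ∀ u ∈ Ioi (0 : ℝ), ∫⁻ x : Plane,
      {u : ℝ | ENNReal.ofReal u < ENNReal.ofReal k * ‖x‖ₑ ^ (-α)}.indicator
        (fun u => ENNReal.ofReal (Real.exp (-u))) u =
      ENNReal.ofReal (Real.pi * k ^ (2 / α) *
        (Real.exp (-u) * u ^ ((1 - 2 / α) - 1))) := by
    intro u hu
    have hu' : 0 < u := hu
    have : ∀ x : Plane, {u : ℝ | ENNReal.ofReal u < ENNReal.ofReal k * ‖x‖ₑ ^ (-α)}.indicator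
        (fun u => ENNReal.ofReal (Real.exp (-u))) u = (Metric.ball (0 : Plane)
          ((k / u) ^ α⁻¹)).indicator (fun _ => ENNReal.ofReal (Real.exp (-u))) x := by
      intro x
      rw [← hball u hu]
      rfl
    rw [lintegral_congr this, lintegral_indicator_const measurableSet_ball,
      EuclideanSpace.volume_ball_fin_two, ← ENNReal.ofReal_pow (by positivity),
      ← ENNReal.ofReal_mul (by positivity),
      ← ENNReal.ofReal_mul (by positivity)]
    congr 1
    rw [← Real.rpow_natCast, ← Real.rpow_mul (by positivity), Real.div_rpow hk.le hu'.le,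
      show α⁻¹ * (2 : ℕ) = 2 / α by push_cast; ring, show 1 - 2 / α - 1 = -(2 / α) by ring,
      Real.rpow_neg hu'.le]
    ring
  have hs : 0 < 1 - 2 / α := by
    rw [sub_pos, div_lt_one hα0]; exact hα
  rw [setLIntegral_congr_fun measurableSet_Ioi hinner, ← ofReal_integral_eq_lintegral_ofReal,
    integral_const_mul, ← Real.Gamma_eq_integral hs]
  · congr 1
    ring
  · exact (Real.GammaIntegral_convergent hs).const_mul _
  · refine (ae_restrict_iff' measurableSet_Ioi).2 (ae_of_all _ fun u (hu : 0 < u) => ?_)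
    positivity

/-! ### Integrals against Gamma laws -/

lemma lintegral_gammaMeasure (a r : ℝ) {f : ℝ → ℝ≥0∞} (hf : Measurable f) :
    ∫⁻ x, f x ∂(gammaMeasure a r) =
      ∫⁻ x in Ioi 0, ENNReal.ofReal (gammaPDFReal a r x) * f x := by
  have hm : Measurable (gammaPDF a r) := (measurable_gammaPDFReal a r).ennreal_ofReal
  rw [gammaMeasure, lintegral_withDensity_eq_lintegral_mul _ hm hf,
    setLIntegral_congr Ioi_ae_eq_Ici, ← lintegral_indicator measurableSet_Ici]
  refine lintegral_congr fun x => ?_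
  by_cases hx : 0 ≤ x
  · rw [indicator_of_mem (mem_Ici.2 hx)]; rfl
  · rw [indicator_of_notMem (by simpa using hx), Pi.mul_apply, gammaPDF_of_neg (not_le.1 hx),
      zero_mul]

/-- Dividing a Gamma variable of rate `r` by `y` multiplies its rate by `y`. -/
lemma lintegral_gammaMeasure_comp_div (a : ℝ) {r y : ℝ} (hr : 0 < r) (hy : 0 < y) {f : ℝ → ℝ≥0∞}
    (hf : Measurable f) :
    ∫⁻ x, f (x / y) ∂(gammaMeasure a r) =
      ∫⁻ z in Ioi 0, ENNReal.ofReal (gammaPDFReal a (r * y) z) * f z := by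
  rw [lintegral_gammaMeasure a r (f := fun x => f (x / y)) (by fun_prop)]
  have hF : Measurable ((Ioi 0).indicator
      fun x => ENNReal.ofReal (gammaPDFReal a r x) * f (x / y)) :=
    Measurable.indicator (by fun_prop) measurableSet_Ioi
  have hF' : Measurable fun z => (Ioi 0).indicator
      (fun x => ENNReal.ofReal (gammaPDFReal a r x) * f (x / y)) (y * z) := hF.comp (by fun_prop)
  rw [← lintegral_indicator measurableSet_Ioi, ← lintegral_indicator measurableSet_Ioi]
  conv_lhs => rw [← Real.smul_map_volume_mul_left hy.ne']
  rw [lintegral_smul_measure, lintegral_map hF (by fun_prop), smul_eq_mul,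
    ← lintegral_const_mul _ hF']
  refine lintegral_congr fun z => ?_
  by_cases hz : 0 < z
  · rw [indicator_of_mem (mem_Ioi.2 (mul_pos hy hz)), indicator_of_mem (mem_Ioi.2 hz),
      mul_div_cancel_left₀ _ hy.ne', ← mul_assoc, ← ENNReal.ofReal_mul (abs_nonneg _),
      abs_of_pos hy, gammaPDFReal, gammaPDFReal, if_pos hz.le, if_pos (mul_pos hy hz).le,
      Real.mul_rpow hy.le hz.le, Real.mul_rpow hr.le hy.le, Real.rpow_sub_one hy.ne']
    congr 2
    field_simp
  · rw [indicator_of_notMem (by rw [mem_Ioi, mul_pos_iff_of_pos_left hy]; exact hz),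
      indicator_of_notMem (show z ∉ Ioi 0 from hz), mul_zero]

lemma lintegral_rpow_gammaMeasure {a r p c : ℝ} (ha : 0 < a) (hr : 0 < r) (hp : 0 ≤ p)
    (hc : 0 ≤ c) :
    ∫⁻ x, ENNReal.ofReal (c * x ^ p) ∂(gammaMeasure a r) =
      ENNReal.ofReal (c * (Real.Gamma (p + a) / Real.Gamma a) * r ^ (-p)) := by
  have hG := Real.Gamma_pos_of_pos ha
  rw [lintegral_gammaMeasure a r (by fun_prop)]
  have h1 : ∀ x ∈ Ioi (0 : ℝ), ENNReal.ofReal (gammaPDFReal a r x) * ENNReal.ofReal (c * x ^ p) =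
      ENNReal.ofReal (c * r ^ a / Real.Gamma a * (x ^ (p + a - 1) * Real.exp (-(r * x)))) := by
    intro x (hx : 0 < x)
    rw [← ENNReal.ofReal_mul (gammaPDFReal_nonneg ha hr x), gammaPDFReal, if_pos hx.le,
      add_sub_assoc, Real.rpow_add hx]
    congr 1
    ring
  have hint : IntegrableOn (fun x : ℝ => x ^ (p + a - 1) * Real.exp (-(r * x))) (Ioi 0) := by
    have := integrableOn_rpow_mul_exp_neg_mul_rpow (s := p + a - 1) (p := 1) (b := r)
      (by linarith) one_pos hr
    simpa using this
  rw [setLIntegral_congr_fun measurableSet_Ioi h1, ← ofReal_integral_eq_lintegral_ofReal,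
    integral_const_mul, Real.integral_rpow_mul_exp_neg_mul_Ioi (by linarith) hr]
  · congr 1
    rw [Real.div_rpow zero_le_one hr.le, Real.one_rpow, Real.rpow_add hr, Real.rpow_neg hr.le]
    have := Real.rpow_pos_of_pos hr a
    have := Real.rpow_pos_of_pos hr p
    field_simp
  · exact hint.const_mul _
  · refine (ae_restrict_iff' measurableSet_Ioi).2 (ae_of_all _ fun x (hx : 0 < x) => ?_)
    have : 0 ≤ c * r ^ a / Real.Gamma a := by positivity
    positivity

/-! ### Laplace transform of the interference -/

/-- The constant `K` such that an interference field of density `lam` has Laplace transform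
`exp (-π lam K θ ^ (2 / α))`. -/
noncomputable def interferenceConst (α d mI : ℝ) : ℝ :=
  Real.Gamma (1 - 2 / α) * d ^ 2 * (Real.Gamma (2 / α + mI) / Real.Gamma mI) * mI ^ (-(2 / α))

section
variable {Ω : Type*} [MeasurableSpace Ω] {μ : Measure Ω}

lemma measurable_interference {α d : ℝ} {X : ℕ → Ω → Plane} {h : ℕ → Ω → ℝ}
    (hX : ∀ i, Measurable (X i)) (hh : ∀ i, Measurable (h i)) :
    Measurable fun ω => interference α d (fun i => X i ω) (fun i => h i ω) := by
  unfold interference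
  fun_prop

/-- For a mark `y` the plane integral is proportional to `(y θ d^α)^(2/α)`. The mark average is thus
a Gamma moment of order `2/α`, and `d^α` contributes `d^2`. -/
lemma lintegral_negExp_interference [IsProbabilityMeasure μ] {α d lam mI θ : ℝ} (hα : 2 < α)
    (hd : 0 < d) (hlam : 0 ≤ lam) (hmI : 0 < mI) (hθ : 0 < θ) {X : ℕ → Ω → Plane}
    {h : ℕ → Ω → ℝ} (hX : IsPoissonPointProcess μ lam X) (hh : ∀ i, Measurable (h i))
    (hlaw : ∀ i, HasLaw (h i) (nakagamiGainLaw mI) μ) (hind : iIndepFun h μ)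
    (hXh : IndepFun (fun ω i => X i ω) (fun ω i => h i ω) μ) :
    ∫⁻ ω, negExp (ENNReal.ofReal θ *
        interference α d (fun i => X i ω) (fun i => h i ω)) ∂μ =
      ENNReal.ofReal (Real.exp (-(Real.pi * lam * interferenceConst α d mI * θ ^ (2 / α)))) := by
  have := isProbabilityMeasure_gammaMeasure hmI hmI
  unfold nakagamiGainLaw at hlaw
  have hα0 : 0 < α := by linarith
  have hs : 0 < 1 - 2 / α := by
    rw [sub_pos, div_lt_one hα0]; exact hα
  have hG := Real.Gamma_pos_of_pos hs
  set κ : ℝ := θ * d ^ α with hκ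
  have hκ0 : 0 < κ := by positivity
  set r : Plane → ℝ≥0∞ := fun x => ENNReal.ofReal κ * ‖x‖ₑ ^ (-α) with hr
  have hrm : Measurable r := by fun_prop
  have hI : ∀ ω, ENNReal.ofReal θ * interference α d (fun i => X i ω) (fun i => h i ω) =
      ∑' i, ENNReal.ofReal (h i ω) * r (X i ω) := by
    intro ω
    rw [interference, ← mul_assoc, ENNReal.ofReal_rpow_of_pos hd, ← ENNReal.ofReal_mul hθ.le,
      ← ENNReal.tsum_mul_left]
    refine tsum_congr fun i => ?_
    rw [hr, ← hκ]
    ring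
  simp_rw [hI]
  rw [lintegral_negExp_tsum_mark hX hlam hh hlaw hind hXh hrm,
    lintegral_lintegral_swap (by unfold Function.uncurry; fun_prop)]
  have hin : ∫⁻ y, (∫⁻ x : Plane, (1 - negExp (ENNReal.ofReal y * r x))) ∂(gammaMeasure mI mI) =
      ∫⁻ y, ENNReal.ofReal (Real.pi * Real.Gamma (1 - 2 / α) * κ ^ (2 / α) * y ^ (2 / α))
        ∂(gammaMeasure mI mI) := by
    have hm : Measurable fun y : ℝ => ∫⁻ x : Plane, (1 - negExp (ENNReal.ofReal y * r x)) := by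
      refine Measurable.lintegral_prod_right' (f := fun p : ℝ × Plane =>
        1 - negExp (ENNReal.ofReal p.1 * r p.2)) (by fun_prop)
    rw [lintegral_gammaMeasure mI mI hm, lintegral_gammaMeasure mI mI (by fun_prop)]
    refine setLIntegral_congr_fun measurableSet_Ioi fun y (hy : 0 < y) => ?_
    simp only [hr, ← mul_assoc, ← ENNReal.ofReal_mul hy.le]
    rw [lintegral_one_sub_negExp_norm_rpow hα (mul_pos hy hκ0), Real.mul_rpow hy.le hκ0.le]
    congr 2
    ring
  rw [hin, lintegral_rpow_gammaMeasure hmI hmI (by positivity) (by positivity),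
    ← ENNReal.ofReal_mul hlam, negExp_ofReal]
  · congr 3
    rw [hκ, Real.mul_rpow hθ.le (by positivity), ← Real.rpow_mul hd.le,
      mul_div_cancel₀ _ hα0.ne', interferenceConst, Real.rpow_two]
    ring
  · have := Real.Gamma_pos_of_pos hmI
    have := Real.Gamma_pos_of_pos (show 0 < 2 / α + mI by positivity)
    positivity

/-- As `θ ↓ 0`, `exp (-θ J)` tends to the indicator of `J < ∞`, so the limit of the transforms is
the probability of finiteness. -/
lemma ae_ne_top_of_tendsto_lintegral_negExp [IsProbabilityMeasure μ] {J : Ω → ℝ≥0∞}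
    (hJ : Measurable J)
    (hlim : Filter.Tendsto (fun n : ℕ => ∫⁻ ω, negExp (ENNReal.ofReal (1 / (n + 1)) * J ω) ∂μ)
      Filter.atTop (nhds 1)) : ∀ᵐ ω ∂μ, J ω ≠ ∞ := by
  have hs : MeasurableSet {ω | J ω ≠ ∞} := (hJ (measurableSet_singleton ∞)).compl
  have h0 : Filter.Tendsto (fun n : ℕ => ENNReal.ofReal (1 / ((n : ℝ) + 1))) Filter.atTop
      (nhds 0) := by
    simpa using ENNReal.tendsto_ofReal tendsto_one_div_add_atTop_nhds_zero_nat
  have hlim' : Filter.Tendsto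
      (fun n : ℕ => ∫⁻ ω, negExp (ENNReal.ofReal (1 / (n + 1)) * J ω) ∂μ) Filter.atTop
      (nhds (∫⁻ ω, {ω | J ω ≠ ∞}.indicator 1 ω ∂μ)) := by
    refine tendsto_lintegral_of_dominated_convergence (fun _ => 1) (fun n => by fun_prop)
      (fun n => ae_of_all _ fun ω => negExp_le_one _) (by simp) (ae_of_all _ fun ω => ?_)
    by_cases hω : J ω = ∞
    · rw [indicator_of_notMem (by simpa using hω), hω]
      refine tendsto_const_nhds.congr fun n => ?_
      rw [ENNReal.mul_top (ENNReal.ofReal_pos.2 (by positivity)).ne', negExp_top]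
    · rw [indicator_of_mem (by exact hω), Pi.one_apply, ← negExp_zero]
      refine (continuous_negExp.tendsto _).comp ?_
      simpa using ENNReal.Tendsto.mul_const h0 (Or.inr hω)
  rw [lintegral_indicator_one hs] at hlim'
  exact (prob_compl_eq_zero_iff hs).2 (tendsto_nhds_unique hlim' hlim)

/-- Laplace transform of an almost surely finite interference power, as a Bochner integral. -/
lemma interference_finite_and_integral_exp [IsProbabilityMeasure μ] {α d lam mI : ℝ} (hα : 2 < α)
    (hd : 0 < d) (hlam : 0 ≤ lam) (hmI : 0 < mI) {X : ℕ → Ω → Plane}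
    {h : ℕ → Ω → ℝ} (hX : IsPoissonPointProcess μ lam X) (hh : ∀ i, Measurable (h i))
    (hlaw : ∀ i, HasLaw (h i) (nakagamiGainLaw mI) μ) (hind : iIndepFun h μ)
    (hXh : IndepFun (fun ω i => X i ω) (fun ω i => h i ω) μ) :
    (∀ᵐ ω ∂μ, interference α d (fun i => X i ω) (fun i => h i ω) ≠ ∞) ∧
    ∀ u, 0 ≤ u →
      ∫ ω, Real.exp (-(u * (interference α d (fun i => X i ω) (fun i => h i ω)).toReal)) ∂μ =
        Real.exp (-(Real.pi * lam * interferenceConst α d mI * u ^ (2 / α))) := by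
  have hα0 : 0 < α := by linarith
  have hp : 0 < 2 / α := by positivity
  have hJ := measurable_interference (α := α) (d := d) hX.measurable hh
  have hfin : ∀ᵐ ω ∂μ, interference α d (fun i => X i ω) (fun i => h i ω) ≠ ∞ := by
    refine ae_ne_top_of_tendsto_lintegral_negExp hJ ?_
    have h1 : ∀ n : ℕ, (0 : ℝ) < 1 / (n + 1) := fun n => by positivity
    simp_rw [fun n : ℕ => lintegral_negExp_interference hα hd hlam hmI (h1 n) hX hh hlaw hind hXh]
    have hc : Continuous fun u : ℝ => ENNReal.ofReal
        (Real.exp (-(Real.pi * lam * interferenceConst α d mI * u ^ (2 / α)))) := by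
      have := Real.continuous_rpow_const hp.le
      exact ENNReal.continuous_ofReal.comp (by fun_prop)
    have := (hc.tendsto 0).comp tendsto_one_div_add_atTop_nhds_zero_nat
    simpa [Function.comp_def, Real.zero_rpow hp.ne'] using this
  refine ⟨hfin, fun u hu => ?_⟩
  rcases hu.eq_or_lt with rfl | hu
  · simp [Real.zero_rpow hp.ne']
  rw [integral_eq_lintegral_of_nonneg_ae (ae_of_all _ fun ω => (Real.exp_pos _).le)
    (Measurable.aestronglyMeasurable (by fun_prop)),
    ← ENNReal.toReal_ofReal (Real.exp_pos (-(_ * _))).le,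
    ← lintegral_negExp_interference hα hd hlam hmI hu hX hh hlaw hind hXh]
  congr 1
  refine lintegral_congr_ae ?_
  filter_upwards [hfin] with ω hω
  rw [← negExp_ofReal (by positivity), ENNReal.ofReal_mul hu.le, ENNReal.ofReal_toReal hω]

end

/-! ### Erlang tails and sums of two scaled Erlang variables -/

/-- The tail `∑_{k < m} (r w⁺) ^ k / k! exp (-r w⁺)` of the Gamma law with integer shape `m` and
rate `r` (an Erlang law). -/
noncomputable def erlangTail (m : ℕ) (r w : ℝ) : ℝ :=
  ∑ k ∈ Finset.range m, (r * max 0 w) ^ k / k ! * Real.exp (-(r * max 0 w))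

/-- The derivatives of consecutive terms telescope, leaving minus the Erlang density of shape `n +
1`; the sum is hence the Erlang tail. -/
lemma hasDerivAt_sum_pow_div_factorial_mul_exp_neg (n : ℕ) (r u : ℝ) :
    HasDerivAt (fun u => ∑ k ∈ Finset.range (n + 1), (r * u) ^ k / k ! * Real.exp (-(r * u)))
      (-(r * ((r * u) ^ n / n ! * Real.exp (-(r * u))))) u := by
  have hl : HasDerivAt (fun u => r * u) r u := by simpa using (hasDerivAt_id u).const_mul r
  have he : HasDerivAt (fun u => Real.exp (-(r * u))) (Real.exp (-(r * u)) * -r) u := hl.neg.exp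
  induction n with
  | zero => simpa [mul_comm] using he
  | succ n ih =>
    simp_rw [Finset.sum_range_succ _ (n + 1)]
    refine (ih.add (((hl.pow (n + 1)).div_const ((n + 1)! : ℝ)).mul he)).congr_deriv ?_
    rw [Nat.factorial_succ, Pi.pow_apply]
    push_cast
    have : (n ! : ℝ) ≠ 0 := by positivity
    have : (n + 1 : ℝ) ≠ 0 := by positivity
    field_simp
    simp

lemma gammaMeasure_Ici {m : ℕ} (hm : 1 ≤ m) {r : ℝ} (hr : 0 < r) (w : ℝ) :
    gammaMeasure m r (Ici w) = ENNReal.ofReal (erlangTail m r w) := by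
  obtain ⟨n, rfl⟩ : ∃ n, m = n + 1 := ⟨m - 1, by omega⟩
  rw [← lintegral_indicator_one measurableSet_Ici,
    lintegral_gammaMeasure _ _ (measurable_one.indicator measurableSet_Ici)]
  have h1 : ∫⁻ x in Ioi 0, ENNReal.ofReal (gammaPDFReal ((n + 1 : ℕ) : ℝ) r x) *
        (Ici w).indicator 1 x =
      ∫⁻ x in Ioi (max 0 w), ENNReal.ofReal (r * ((r * x) ^ n / n ! * Real.exp (-(r * x)))) := by
    have hset : (Ioi (max 0 w) : Set ℝ) =ᵐ[volume] (Ioi 0 ∩ Ici w : Set ℝ) := by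
      rw [← Ioi_inter_Ioi]
      exact (Filter.EventuallyEq.refl _ _).inter Ioi_ae_eq_Ici
    rw [setLIntegral_congr hset, inter_comm, ← Measure.restrict_restrict measurableSet_Ici,
      ← lintegral_indicator measurableSet_Ici]
    refine setLIntegral_congr_fun measurableSet_Ioi fun x (hx : 0 < x) => ?_
    by_cases hxw : x ∈ Ici w
    · simp only [indicator_of_mem hxw, Pi.one_apply, mul_one]
      rw [gammaPDFReal, if_pos hx.le, Nat.cast_succ, Real.Gamma_nat_eq_factorial,
        add_sub_cancel_right, Real.rpow_natCast, ← Nat.cast_succ, Real.rpow_natCast]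
      rw [pow_succ]
      congr 1
      ring
    · simp [indicator_of_notMem hxw]
  have hderiv := fun x (_ : x ∈ Ici (max 0 w)) =>
    (hasDerivAt_sum_pow_div_factorial_mul_exp_neg n r x).neg
  have hpos : ∀ x ∈ Ioi (max 0 w), 0 ≤ - -(r * ((r * x) ^ n / n ! * Real.exp (-(r * x)))) := by
    intro x hx
    have : 0 < x := (le_max_left _ _).trans_lt hx
    rw [neg_neg]
    positivity
  have hlim : Filter.Tendsto (-fun u : ℝ => ∑ k ∈ Finset.range (n + 1),
      (r * u) ^ k / k ! * Real.exp (-(r * u))) Filter.atTop (nhds 0) := by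
    rw [← neg_zero]
    refine Filter.Tendsto.neg ?_
    rw [← Finset.sum_const_zero (s := Finset.range (n + 1))]
    refine tendsto_finsetSum _ fun k _ => ?_
    have := ((Real.tendsto_pow_mul_exp_neg_atTop_nhds_zero k).comp
      (Filter.tendsto_id.const_mul_atTop hr)).div_const (k ! : ℝ)
    rw [zero_div] at this
    refine this.congr fun u => ?_
    simp only [Function.comp_apply, id]
    ring
  have hI := integral_Ioi_of_hasDerivAt_of_nonneg' hderiv hpos hlim
  have hint := integrableOn_Ioi_deriv_of_nonneg' hderiv hpos hlim
  simp only [neg_neg] at hI hint hpos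
  rw [h1, ← ofReal_integral_eq_lintegral_ofReal hint
    ((ae_restrict_iff' measurableSet_Ioi).2 (ae_of_all _ hpos)), hI, erlangTail]
  simp

lemma measurable_gammaPDFReal_uncurry (a : ℝ) :
    Measurable fun p : ℝ × ℝ => gammaPDFReal a p.1 p.2 := by
  unfold gammaPDFReal
  exact Measurable.ite (measurableSet_le measurable_const measurable_snd) (by fun_prop)
    measurable_const

lemma measurable_erlangTail_uncurry (m : ℕ) :
    Measurable fun p : ℝ × ℝ => erlangTail m p.1 p.2 := by
  unfold erlangTail
  fun_prop

section
variable {Ω : Type*} [MeasurableSpace Ω] {μ : Measure Ω}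

/-- Given `g₂`, the event is a tail event for `g₁`; the variable `z` is the value of `g₂ / y₂`, of
rate `r * y₂`. -/
lemma lintegral_indicator_le_div_add_div [IsProbabilityMeasure μ] {m : ℕ} (hm : 1 ≤ m) {r T : ℝ}
    (hr : 0 < r) {g₁ g₂ : Ω → ℝ} (hg₁ : Measurable g₁) (hg₂ : Measurable g₂)
    (hlaw₁ : HasLaw g₁ (gammaMeasure m r) μ) (hlaw₂ : HasLaw g₂ (gammaMeasure m r) μ)
    (hg : IndepFun g₂ g₁ μ) {y₁ y₂ : ℝ} (h₁ : 0 < y₁) (h₂ : 0 < y₂) :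
    ∫⁻ ω, {p : ℝ × ℝ | T ≤ p.2 / y₁ + p.1 / y₂}.indicator 1 (g₂ ω, g₁ ω) ∂μ =
      ∫⁻ z in Ioi 0, ENNReal.ofReal (gammaPDFReal m (r * y₂) z) *
        ENNReal.ofReal (erlangTail m (r * y₁) (T - z)) := by
  have htail := measurable_erlangTail_uncurry m
  have hs : MeasurableSet {p : ℝ × ℝ | T ≤ p.2 / y₁ + p.1 / y₂} :=
    measurableSet_le (by fun_prop) (by fun_prop)
  rw [lintegral_comp_of_indepFun hg₂ hg₁ hg
    (H := fun a b => {p : ℝ × ℝ | T ≤ p.2 / y₁ + p.1 / y₂}.indicator 1 (a, b))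
    (measurable_one.indicator hs)]
  have h3 : ∀ ω, ∫⁻ ω', {p : ℝ × ℝ | T ≤ p.2 / y₁ + p.1 / y₂}.indicator
      (1 : ℝ × ℝ → ℝ≥0∞) (g₂ ω, g₁ ω') ∂μ =
      ENNReal.ofReal (erlangTail m (r * y₁) (T - g₂ ω / y₂)) := by
    intro ω
    have h4 : ∀ x : ℝ, {p : ℝ × ℝ | T ≤ p.2 / y₁ + p.1 / y₂}.indicator
        (1 : ℝ × ℝ → ℝ≥0∞) (g₂ ω, x) = (Ici (y₁ * (T - g₂ ω / y₂))).indicator 1 x := by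
      intro x
      refine indicator_eq_indicator ?_ rfl
      rw [mem_ofPred_eq, mem_Ici, ← sub_le_iff_le_add, le_div_iff₀' h₁]
    simp_rw [h4]
    rw [hlaw₁.lintegral_comp (f := (Ici (y₁ * (T - g₂ ω / y₂))).indicator 1)
      (measurable_one.indicator measurableSet_Ici).aemeasurable,
      lintegral_indicator_one measurableSet_Ici, gammaMeasure_Ici hm hr]
    congr 1
    unfold erlangTail
    rw [← mul_zero y₁, ← mul_max_of_nonneg _ _ h₁.le, mul_zero, ← mul_assoc]
  simp_rw [h3]
  have hme : Measurable fun z => ENNReal.ofReal (erlangTail m (r * y₁) (T - z)) :=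
    (htail.comp (f := fun z => (r * y₁, T - z)) (by fun_prop)).ennreal_ofReal
  rw [hlaw₂.lintegral_comp (f := fun x => ENNReal.ofReal (erlangTail m (r * y₁) (T - x / y₂)))
    (hme.comp (by fun_prop : Measurable fun x : ℝ => x / y₂)).aemeasurable,
    lintegral_gammaMeasure_comp_div _ hr h₂ hme]

/-- The law of a sum of two randomly scaled Erlang variables. -/
lemma measure_le_div_add_div [IsProbabilityMeasure μ] {m : ℕ} (hm : 1 ≤ m) {r T : ℝ} (hr : 0 < r)
    {g₁ g₂ Y₁ Y₂ : Ω → ℝ} (hg₁ : Measurable g₁) (hg₂ : Measurable g₂) (hY₁ : Measurable Y₁)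
    (hY₂ : Measurable Y₂) (hpos₁ : ∀ ω, 0 < Y₁ ω) (hpos₂ : ∀ ω, 0 < Y₂ ω)
    (hlaw₁ : HasLaw g₁ (gammaMeasure m r) μ) (hlaw₂ : HasLaw g₂ (gammaMeasure m r) μ)
    (hg : IndepFun g₂ g₁ μ) (hY : IndepFun Y₁ Y₂ μ)
    (hYg : IndepFun (fun ω => (Y₁ ω, Y₂ ω)) (fun ω => (g₂ ω, g₁ ω)) μ) :
    μ {ω | T ≤ g₁ ω / Y₁ ω + g₂ ω / Y₂ ω} =
      ∫⁻ z in Ioi 0, (∫⁻ ω, ENNReal.ofReal (gammaPDFReal m (r * Y₂ ω) z) ∂μ) *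
        ∫⁻ ω, ENNReal.ofReal (erlangTail m (r * Y₁ ω) (T - z)) ∂μ := by
  have hpdf := measurable_gammaPDFReal_uncurry m
  have htail := measurable_erlangTail_uncurry m
  have hs : MeasurableSet {q : (ℝ × ℝ) × (ℝ × ℝ) | T ≤ q.2.2 / q.1.1 + q.2.1 / q.1.2} :=
    measurableSet_le (by fun_prop) (by fun_prop)
  have hms : MeasurableSet {ω | T ≤ g₁ ω / Y₁ ω + g₂ ω / Y₂ ω} :=
    measurableSet_le (by fun_prop) (by fun_prop)
  rw [← lintegral_indicator_one hms]
  have h5 := lintegral_comp_of_indepFun (hY₁.prodMk hY₂) (hg₂.prodMk hg₁) hYg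
    (H := fun a b => {q : (ℝ × ℝ) × (ℝ × ℝ) | T ≤ q.2.2 / q.1.1 + q.2.1 / q.1.2}.indicator 1 (a, b))
    (measurable_one.indicator hs)
  have h0 : ∀ ω, {ω | T ≤ g₁ ω / Y₁ ω + g₂ ω / Y₂ ω}.indicator (1 : Ω → ℝ≥0∞) ω =
      {q : (ℝ × ℝ) × (ℝ × ℝ) | T ≤ q.2.2 / q.1.1 + q.2.1 / q.1.2}.indicator 1
        ((Y₁ ω, Y₂ ω), (g₂ ω, g₁ ω)) := fun ω => indicator_eq_indicator Iff.rfl rfl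
  have h8 : ∀ ω, ∫⁻ ω', {q : (ℝ × ℝ) × (ℝ × ℝ) |
      T ≤ q.2.2 / q.1.1 + q.2.1 / q.1.2}.indicator (1 : (ℝ × ℝ) × (ℝ × ℝ) → ℝ≥0∞)
        ((Y₁ ω, Y₂ ω), (g₂ ω', g₁ ω')) ∂μ = _ := fun ω =>
    (lintegral_congr fun ω' => indicator_eq_indicator Iff.rfl rfl).trans
      (lintegral_indicator_le_div_add_div hm hr hg₁ hg₂ hlaw₁ hlaw₂ hg
      (T := T) (hpos₁ ω) (hpos₂ ω))
  rw [lintegral_congr h0, h5, lintegral_congr h8]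
  have hm1 : Measurable fun p : Ω × ℝ => ENNReal.ofReal (gammaPDFReal m (r * Y₂ p.1) p.2) :=
    (hpdf.comp (f := fun p : Ω × ℝ => (r * Y₂ p.1, p.2)) (by fun_prop)).ennreal_ofReal
  have hm2 : Measurable fun p : Ω × ℝ => ENNReal.ofReal (erlangTail m (r * Y₁ p.1) (T - p.2)) :=
    (htail.comp (f := fun p : Ω × ℝ => (r * Y₁ p.1, T - p.2)) (by fun_prop)).ennreal_ofReal
  -- With `z` outside, the integrand is a function of `Y₂` times a function of `Y₁`, so independence
  -- splits the expectation.
  rw [lintegral_lintegral_swap (hm1.mul hm2).aemeasurable]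
  refine lintegral_congr fun z => ?_
  have h6 : Measurable fun y : ℝ => ENNReal.ofReal (gammaPDFReal m (r * y) z) :=
    (hpdf.comp (f := fun y : ℝ => (r * y, z)) (by fun_prop)).ennreal_ofReal
  have h7 : Measurable fun y : ℝ => ENNReal.ofReal (erlangTail m (r * y) (T - z)) :=
    (htail.comp (f := fun y : ℝ => (r * y, T - z)) (by fun_prop)).ennreal_ofReal
  exact lintegral_mul_eq_lintegral_mul_lintegral_of_indepFun (μ := μ)
    (h6.comp hY₂) (h7.comp hY₁) (hY.symm.comp h6 h7)

/-! ### Probabilities as derivatives of Laplace transforms -/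

/-- Derivatives at `1` of a function that agrees with `t ↦ E[exp (-c t Y)]` for `t > 0`. -/
lemma iteratedDeriv_laplace [IsProbabilityMeasure μ] {Y : Ω → ℝ} (hY : Measurable Y)
    (hY0 : ∀ ω, 0 ≤ Y ω) {c : ℝ} (hc : 0 ≤ c) {F : ℝ → ℝ}
    (hF : ∀ t, 0 < t → F t = ∫ ω, Real.exp (-(c * t * Y ω)) ∂μ) (k : ℕ) :
    Integrable (fun ω => (-(c * Y ω)) ^ k * Real.exp (-(c * Y ω))) μ ∧
      iteratedDeriv k F 1 = ∫ ω, (-(c * Y ω)) ^ k * Real.exp (-(c * Y ω)) ∂μ := by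
  set Z : Ω → ℝ := fun ω => -(c * Y ω) with hZ
  -- Since `Z ≤ 0`, the exponential moments exist for all `t > 0`. Thus `1` is an interior point and
  -- the moment generating function may be differentiated under the expectation there.
  have hint : Ioi 0 ⊆ integrableExpSet Z μ := by
    intro t (ht : 0 < t)
    refine Integrable.of_bound (C := 1) (by fun_prop) (ae_of_all _ fun ω => ?_)
    rw [Real.norm_of_nonneg (Real.exp_pos _).le, Real.exp_le_one_iff]
    have := mul_nonneg hc (hY0 ω)
    simp only [hZ]
    nlinarith
  have h1 : (1 : ℝ) ∈ interior (integrableExpSet Z μ) :=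
    interior_maximal hint isOpen_Ioi (mem_Ioi.2 one_pos)
  have heq : F =ᶠ[nhds 1] mgf Z μ := by
    filter_upwards [Ioi_mem_nhds (zero_lt_one' ℝ)] with t ht
    rw [hF t ht, mgf]
    refine integral_congr_ae (ae_of_all _ fun ω => ?_)
    simp only [hZ]
    congr 1
    ring
  constructor
  · simpa using integrable_pow_mul_exp_of_mem_interior_integrableExpSet h1 k
  · rw [heq.iteratedDeriv_eq, iteratedDeriv_mgf h1]
    simp [hZ]

end

section
variable {Ω : Type*} [MeasurableSpace Ω] {μ : Measure Ω}

/-- The density at `z` is `z⁻¹ (r z Y)^m exp (-r z Y) / Γ(m)`, and `(-(r z Y))^m exp (-r z Y)` is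
the `m`-th derivative of `exp (-r z t Y)` at `t = 1`. This is the origin of `z⁻¹` and `(-1)^m` in
the formula. -/
lemma lintegral_gammaPDFReal_eq_iteratedDeriv [IsProbabilityMeasure μ] {m : ℕ} (hm : 1 ≤ m)
    {Y : Ω → ℝ} (hY : Measurable Y) (hpos : ∀ ω, 0 < Y ω) {r z : ℝ} (hr : 0 < r) (hz : 0 < z)
    {F : ℝ → ℝ} (hF : ∀ t, 0 < t → F t = ∫ ω, Real.exp (-(r * z * t * Y ω)) ∂μ) :
    0 ≤ z⁻¹ * ((-1) ^ m / Real.Gamma m * iteratedDeriv m F 1) ∧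
      ∫⁻ ω, ENNReal.ofReal (gammaPDFReal m (r * Y ω) z) ∂μ =
        ENNReal.ofReal (z⁻¹ * ((-1) ^ m / Real.Gamma m * iteratedDeriv m F 1)) := by
  obtain ⟨hint, hD⟩ := iteratedDeriv_laplace (μ := μ) hY (fun ω => (hpos ω).le)
    (mul_pos hr hz).le hF m
  have hm0 : (0 : ℝ) < m := by exact_mod_cast hm
  have heq : ∀ ω, gammaPDFReal m (r * Y ω) z = z⁻¹ * ((-1) ^ m / Real.Gamma m *
      ((-(r * z * Y ω)) ^ m * Real.exp (-(r * z * Y ω)))) := by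
    intro ω
    have hsq : ((-1 : ℝ) ^ m) * (-1) ^ m = 1 := by rw [← mul_pow]; simp
    rw [gammaPDFReal, if_pos hz.le, neg_pow (r * z * Y ω), Real.rpow_natCast,
      Real.rpow_sub_one hz.ne', Real.rpow_natCast, mul_right_comm r z]
    calc (r * Y ω) ^ m / Real.Gamma m * (z ^ m / z) * Real.exp (-(r * Y ω * z))
        = ((-1 : ℝ) ^ m * (-1) ^ m) *
          ((r * Y ω) ^ m / Real.Gamma m * (z ^ m / z) * Real.exp (-(r * Y ω * z))) := by
          rw [hsq, one_mul]
      _ = _ := by rw [mul_pow _ z]; ring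
  have hnn : ∀ ω, 0 ≤ gammaPDFReal m (r * Y ω) z := fun ω =>
    gammaPDFReal_nonneg hm0 (mul_pos hr (hpos ω)) z
  have hI : ∫ ω, gammaPDFReal m (r * Y ω) z ∂μ =
      z⁻¹ * ((-1) ^ m / Real.Gamma m * iteratedDeriv m F 1) := by
    simp_rw [heq]
    rw [integral_const_mul, integral_const_mul, hD]
  have hint' : Integrable (fun ω => gammaPDFReal m (r * Y ω) z) μ := by
    simp_rw [heq]
    exact (hint.const_mul _).const_mul _
  rw [← hI]
  exact ⟨integral_nonneg hnn, (ofReal_integral_eq_lintegral_ofReal hint' (ae_of_all _ hnn)).symm⟩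

/-- The same device applied to each tail term. For `w ≤ 0` only the term `k = 0` survives, with
value `1`. -/
lemma lintegral_erlangTail_eq_sum_iteratedDeriv [IsProbabilityMeasure μ] (m : ℕ)
    {Y : Ω → ℝ} (hY : Measurable Y) (hpos : ∀ ω, 0 < Y ω) {r w : ℝ} (hr : 0 < r)
    {F : ℝ → ℝ} (hF : ∀ t, 0 < t → F t = ∫ ω, Real.exp (-(r * max 0 w * t * Y ω)) ∂μ) :
    (∀ k, 0 ≤ (-1) ^ k / (k ! : ℝ) * iteratedDeriv k F 1) ∧
      ∫⁻ ω, ENNReal.ofReal (erlangTail m (r * Y ω) w) ∂μ =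
        ∑ k ∈ Finset.range m, ENNReal.ofReal ((-1) ^ k / (k ! : ℝ) * iteratedDeriv k F 1) := by
  set a := max 0 w with ha
  have ha0 : 0 ≤ a := le_max_left _ _
  have hL := iteratedDeriv_laplace (μ := μ) hY (fun ω => (hpos ω).le) (mul_nonneg hr.le ha0) hF
  have heq : ∀ k ω, (r * Y ω * a) ^ k / k ! * Real.exp (-(r * Y ω * a)) =
      (-1) ^ k / (k ! : ℝ) * ((-(r * a * Y ω)) ^ k * Real.exp (-(r * a * Y ω))) := by
    intro k ω
    have hsq : ((-1 : ℝ) ^ k) * (-1) ^ k = 1 := by rw [← mul_pow]; simp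
    rw [neg_pow (r * a * Y ω), mul_right_comm r a]
    calc _ = ((-1 : ℝ) ^ k * (-1) ^ k) *
          ((r * Y ω * a) ^ k / k ! * Real.exp (-(r * Y ω * a))) := by rw [hsq, one_mul]
      _ = _ := by ring
  have hnn : ∀ k ω, 0 ≤ (r * Y ω * a) ^ k / k ! * Real.exp (-(r * Y ω * a)) := fun k ω => by
    have := (hpos ω).le
    positivity
  have hI : ∀ k, ∫ ω, (r * Y ω * a) ^ k / k ! * Real.exp (-(r * Y ω * a)) ∂μ =
      (-1) ^ k / (k ! : ℝ) * iteratedDeriv k F 1 := by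
    intro k
    simp_rw [heq]
    rw [integral_const_mul, (hL k).2]
  have hint : ∀ k, Integrable
      (fun ω => (r * Y ω * a) ^ k / k ! * Real.exp (-(r * Y ω * a))) μ := by
    intro k
    simp_rw [heq]
    exact (hL k).1.const_mul _
  refine ⟨fun k => hI k ▸ integral_nonneg (hnn k), ?_⟩
  simp_rw [erlangTail, ← ha]
  rw [lintegral_congr fun ω => ENNReal.ofReal_sum_of_nonneg fun k _ => hnn k ω,
    lintegral_finsetSum _ fun k _ => by fun_prop]
  refine Finset.sum_congr rfl fun k _ => ?_
  rw [← hI, ofReal_integral_eq_lintegral_ofReal (hint k) (ae_of_all _ (hnn k))]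

/-- The tail probability of a sum of two randomly scaled Erlang variables in terms of the
derivatives of the Laplace transforms of the scales. -/
lemma measureReal_le_div_add_div [IsProbabilityMeasure μ] {m : ℕ} (hm : 1 ≤ m) {r T : ℝ}
    (hr : 0 < r) {g₁ g₂ Y₁ Y₂ : Ω → ℝ} (hg₁ : Measurable g₁) (hg₂ : Measurable g₂)
    (hY₁ : Measurable Y₁) (hY₂ : Measurable Y₂) (hpos₁ : ∀ ω, 0 < Y₁ ω) (hpos₂ : ∀ ω, 0 < Y₂ ω)
    (hlaw₁ : HasLaw g₁ (gammaMeasure m r) μ) (hlaw₂ : HasLaw g₂ (gammaMeasure m r) μ)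
    (hg : IndepFun g₂ g₁ μ) (hY : IndepFun Y₁ Y₂ μ)
    (hYg : IndepFun (fun ω => (Y₁ ω, Y₂ ω)) (fun ω => (g₂ ω, g₁ ω)) μ) {B : ℝ → ℝ → ℝ}
    (hB₁ : ∀ a t, 0 ≤ a → 0 < t → B a t = ∫ ω, Real.exp (-(r * a * t * Y₁ ω)) ∂μ)
    (hB₂ : ∀ a t, 0 ≤ a → 0 < t → B a t = ∫ ω, Real.exp (-(r * a * t * Y₂ ω)) ∂μ) :
    (∀ k < m, IntegrableOn (fun z => z⁻¹ * (iteratedDeriv k (B (max 0 (T - z))) 1 *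
        iteratedDeriv m (B z) 1)) (Ioi 0)) ∧
      μ.real {ω | T ≤ g₁ ω / Y₁ ω + g₂ ω / Y₂ ω} =
        ∑ k ∈ Finset.range m, (-1 : ℝ) ^ (k + m) / ((k ! : ℝ) * Real.Gamma m) *
          ∫ z in Ioi (0 : ℝ), z⁻¹ * (iteratedDeriv k (B (max 0 (T - z))) 1 *
            iteratedDeriv m (B z) 1) := by
  have hΓ : 0 < Real.Gamma m := Real.Gamma_pos_of_pos (by exact_mod_cast hm)
  -- Measurability in the parameter is read off from the integral formula for the derivative, which
  -- is available only for nonnegative parameters; hence `max 0 w`.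
  have hmeas : ∀ k, Measurable fun w => iteratedDeriv k (B (max 0 w)) 1 := by
    intro k
    have : ∀ w, iteratedDeriv k (B (max 0 w)) 1 =
        ∫ ω, (-(r * max 0 w * Y₁ ω)) ^ k * Real.exp (-(r * max 0 w * Y₁ ω)) ∂μ := fun w =>
      (iteratedDeriv_laplace hY₁ (fun ω => (hpos₁ ω).le)
        (mul_nonneg hr.le (le_max_left 0 w)) (fun t ht => hB₁ _ t (le_max_left _ _) ht) k).2
    simp_rw [this]
    refine StronglyMeasurable.measurable (StronglyMeasurable.integral_prod_right
      (f := fun w ω => (-(r * max 0 w * Y₁ ω)) ^ k * Real.exp (-(r * max 0 w * Y₁ ω))) ?_)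
    exact Measurable.stronglyMeasurable (by unfold Function.uncurry; fun_prop)
  set J : ℕ → ℝ → ℝ := fun k z => z⁻¹ * (iteratedDeriv k (B (max 0 (T - z))) 1 *
        iteratedDeriv m (B z) 1) with hJ
  set c : ℕ → ℝ := fun k => (-1 : ℝ) ^ (k + m) / ((k ! : ℝ) * Real.Gamma m) with hc
  have hc0 : ∀ k, c k ≠ 0 := fun k => by simp [hc, hΓ.ne', Nat.factorial_ne_zero]
  have hJm : ∀ k, AEStronglyMeasurable (fun z => c k * J k z) (volume.restrict (Ioi 0)) := by
    intro k
    have h1 : Measurable fun z => c k * (z⁻¹ * (iteratedDeriv k (B (max 0 (T - z))) 1 *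
        iteratedDeriv m (B (max 0 z)) 1)) := by
      have h2 := (hmeas k).comp (by fun_prop : Measurable fun z : ℝ => T - z)
      exact (measurable_inv.mul (h2.mul (hmeas m))).const_mul _
    refine h1.aestronglyMeasurable.congr ((ae_restrict_iff' measurableSet_Ioi).2
      (ae_of_all _ fun z (hz : 0 < z) => ?_))
    simp only [hJ, max_eq_right hz.le]
  have hpoint : ∀ z ∈ Ioi (0 : ℝ), (∀ k, 0 ≤ c k * J k z) ∧
      (∫⁻ ω, ENNReal.ofReal (gammaPDFReal m (r * Y₂ ω) z) ∂μ) *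
        ∫⁻ ω, ENNReal.ofReal (erlangTail m (r * Y₁ ω) (T - z)) ∂μ =
      ∑ k ∈ Finset.range m, ENNReal.ofReal (c k * J k z) := by
    intro z hz
    obtain ⟨hp, hpe⟩ := lintegral_gammaPDFReal_eq_iteratedDeriv hm hY₂ hpos₂ hr hz
      (fun t ht => hB₂ z t (le_of_lt hz) ht)
    obtain ⟨ht, hte⟩ := lintegral_erlangTail_eq_sum_iteratedDeriv (w := T - z) m hY₁ hpos₁ hr
      (fun t ht => hB₁ (max 0 (T - z)) t (le_max_left _ _) ht)
    have hmul : ∀ k, c k * J k z = z⁻¹ * ((-1) ^ m / Real.Gamma m * iteratedDeriv m (B z) 1) *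
        ((-1) ^ k / (k ! : ℝ) * iteratedDeriv k (B (max 0 (T - z))) 1) := by
      intro k
      simp only [hc, hJ, pow_add]
      field_simp
    refine ⟨fun k => hmul k ▸ mul_nonneg hp (ht k), ?_⟩
    rw [hpe, hte, Finset.mul_sum]
    refine Finset.sum_congr rfl fun k _ => ?_
    rw [hmul, ENNReal.ofReal_mul hp]
  have hμ : μ {ω | T ≤ g₁ ω / Y₁ ω + g₂ ω / Y₂ ω} =
      ∑ k ∈ Finset.range m, ∫⁻ z in Ioi 0, ENNReal.ofReal (c k * J k z) := by
    rw [measure_le_div_add_div hm hr hg₁ hg₂ hY₁ hY₂ hpos₁ hpos₂ hlaw₁ hlaw₂ hg hY hYg,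
      setLIntegral_congr_fun measurableSet_Ioi fun z hz => (hpoint z hz).2,
      lintegral_finsetSum' _ fun k _ => (hJm k).aemeasurable.ennreal_ofReal]
  have hnn : ∀ k, 0 ≤ᵐ[volume.restrict (Ioi 0)] fun z => c k * J k z := fun k =>
    (ae_restrict_iff' measurableSet_Ioi).2 (ae_of_all _ fun z hz => (hpoint z hz).1 k)
  -- Each nonnegative summand is at most the total, which is a probability.
  have hfin : ∀ k < m, ∫⁻ z in Ioi 0, ENNReal.ofReal (c k * J k z) ≠ ∞ := by
    intro k hk
    have h1 : ∑ k ∈ Finset.range m, ∫⁻ z in Ioi 0, ENNReal.ofReal (c k * J k z) ≠ ∞ :=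
      hμ ▸ measure_ne_top _ _
    exact ENNReal.sum_ne_top.1 h1 k (Finset.mem_range.2 hk)
  have hint : ∀ k < m, IntegrableOn (fun z => c k * J k z) (Ioi 0) := fun k hk =>
    (lintegral_ofReal_ne_top_iff_integrable (hJm k) (hnn k)).1 (hfin k hk)
  refine ⟨fun k hk => (integrable_const_mul_iff (hc0 k).isUnit _).1 (hint k hk), ?_⟩
  rw [measureReal_def, hμ, ENNReal.toReal_sum fun k hk => hfin k (Finset.mem_range.1 hk)]
  refine Finset.sum_congr rfl fun k hk => ?_
  rw [← integral_const_mul, integral_eq_lintegral_of_nonneg_ae (hnn k) (hJm k)]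

end

/-! ### Application to the no-correlation model -/

/-- One of the two factors of `mrcExp` in the no-correlation model. -/
noncomputable def branchExp (α d lam mI SNR : ℝ) (mD : ℕ) (a s : ℝ) : ℝ :=
  Real.exp (-(a * s * mD / SNR) - Real.pi * lam * (Real.Gamma (1 - 2 / α) * d ^ 2 *
    (Real.Gamma (2 / α + mI) / Real.Gamma mI) * ((mD : ℝ) / mI) ^ (2 / α) * (s * a) ^ (2 / α)))

/-- `ncB` is a function of `s` plus a function of `t`, so the exponential factors and the mixed
derivative becomes a product of one-variable derivatives. -/
lemma mrcExp_ncB (α d lam mI SNR T : ℝ) (mD : ℕ) (z s t : ℝ) :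
    mrcExp mD SNR T lam (ncB α d mI T mD) z s t =
      branchExp α d lam mI SNR mD (max 0 (T - z)) s * branchExp α d lam mI SNR mD z t := by
  rw [mrcExp, branchExp, branchExp, ← Real.exp_add, ncB, mul_comm z t]
  congr 1
  ring

lemma mrcIntegrand_ncB (α d lam mI SNR T : ℝ) (mD k : ℕ) (z : ℝ) :
    mrcIntegrand mD SNR T lam (ncB α d mI T mD) k z =
      z⁻¹ * (iteratedDeriv k (branchExp α d lam mI SNR mD (max 0 (T - z))) 1 *
        iteratedDeriv mD (branchExp α d lam mI SNR mD z) 1) := by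
  simp_rw [mrcIntegrand, mrcExp_ncB]
  rw [← iteratedDeriv_mul_const_field]
  simp_rw [iteratedDeriv_const_mul_field]

lemma contDiffAt_branchExp (α d lam mI SNR : ℝ) (mD : ℕ) {a : ℝ} (ha : 0 ≤ a)
    {n : WithTop ℕ∞} : ContDiffAt ℝ n (branchExp α d lam mI SNR mD a) 1 := by
  unfold branchExp
  have hp : ContDiffAt ℝ n (fun s : ℝ => (s * a) ^ (2 / α)) 1 := by
    -- For `a = 0`, which occurs when `z ≥ T`, the base of the power is constantly `0`; otherwise it
    -- is nonzero at `s = 1`.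
    rcases ha.eq_or_lt with rfl | ha
    · simpa using contDiffAt_const
    · exact ContDiffAt.rpow_const_of_ne (by fun_prop) (by simpa using ha.ne')
  fun_prop

/-- Identifies the factor as the Laplace transform of `I + 1/SNR` at `mD * a * s`. -/
lemma branchExp_eq {α d lam mI SNR : ℝ} (hmI : 0 < mI) {mD : ℕ}
    {a s : ℝ} (ha : 0 ≤ a) (hs : 0 < s) :
    branchExp α d lam mI SNR mD a s = Real.exp (-(mD * a * s * SNR⁻¹)) *
      Real.exp (-(Real.pi * lam * interferenceConst α d mI * (mD * a * s) ^ (2 / α))) := by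
  have hmul : ((mD : ℝ) * a * s) ^ (2 / α) = (mD : ℝ) ^ (2 / α) * (s * a) ^ (2 / α) := by
    rw [mul_assoc, mul_comm a s, Real.mul_rpow (by positivity) (by positivity)]
  rw [branchExp, ← Real.exp_add, interferenceConst, hmul, Real.div_rpow (by positivity) hmI.le,
    Real.rpow_neg hmI.le]
  congr 1
  ring

lemma ae_nonneg_gammaMeasure (a r : ℝ) : ∀ᵐ x ∂(gammaMeasure a r), 0 ≤ x := by
  have h : gammaMeasure a r (Iio 0) = 0 := by
    rw [← lintegral_indicator_one measurableSet_Iio,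
      lintegral_gammaMeasure _ _ (measurable_one.indicator measurableSet_Iio)]
    refine (setLIntegral_congr_fun measurableSet_Ioi fun x (hx : 0 < x) => ?_).trans lintegral_zero
    simp [hx.le]
  rw [ae_iff]
  simpa [Iio] using h

lemma le_sinrMRC_two_iff {SNR T : ℝ} (hSNR : 0 < SNR) {g : Fin 2 → ℝ} {I : Fin 2 → ℝ≥0∞}
    (hg : ∀ n, 0 ≤ g n) (hI : ∀ n, I n ≠ ∞) :
    ENNReal.ofReal T ≤ sinrMRC SNR g I ↔
      T ≤ g 0 / ((I 0).toReal + SNR⁻¹) + g 1 / ((I 1).toReal + SNR⁻¹) := by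
  have hpos : ∀ n, 0 < (I n).toReal + SNR⁻¹ := fun n => by positivity
  have hterm : ∀ n, ENNReal.ofReal (g n) / (I n + (ENNReal.ofReal SNR)⁻¹) =
      ENNReal.ofReal (g n / ((I n).toReal + SNR⁻¹)) := fun n => by
    rw [ENNReal.ofReal_div_of_pos (hpos n), ENNReal.ofReal_add (by positivity) (by positivity),
      ENNReal.ofReal_toReal (hI n), ENNReal.ofReal_inv_of_pos hSNR]
  have hnn : ∀ n, 0 ≤ g n / ((I n).toReal + SNR⁻¹) := fun n => div_nonneg (hg n) (hpos n).le
  rw [sinrMRC, Fin.sum_univ_two, hterm, hterm, ← ENNReal.ofReal_add (hnn 0) (hnn 1),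
    ENNReal.ofReal_le_ofReal_iff (add_nonneg (hnn 0) (hnn 1))]

theorem mainTheorem5 {Ω : Type*} [MeasurableSpace Ω] (μ : Measure Ω) [IsProbabilityMeasure μ]
    (α d lam mI SNR T : ℝ) (mD : ℕ)
    (hα : 2 < α) (hd : 0 < d) (hlam : 0 < lam) (hmI : 0 < mI) (hmD : 1 ≤ mD)
    (hSNR : 0 < SNR) (hT : 0 < T)
    (g : Fin 2 → Ω → ℝ) (X : Fin 2 → ℕ → Ω → Plane) (h : Fin 2 → ℕ → Ω → ℝ)
    (hmodel : IsNCModel μ α d lam mD mI g X h) :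
    (∀ z : ℝ, 0 < z →
      ContDiffAt ℝ ((⊤ : ℕ∞) : WithTop ℕ∞)
        (fun p : ℝ × ℝ => mrcExp mD SNR T lam (ncB α d mI T mD) z p.1 p.2) (1, 1)) ∧
    (∀ k < mD, IntegrableOn (mrcIntegrand mD SNR T lam (ncB α d mI T mD) k) (Ioi 0)) ∧
    successProbMRC μ α d SNR T g X h = mrcFormula mD SNR T lam (ncB α d mI T mD) := by
  have hmD0 : (0 : ℝ) < mD := by exact_mod_cast hmD
  refine ⟨fun z hz => ?_, ?_⟩
  · simp_rw [mrcExp_ncB]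
    exact (ContDiffAt.comp (1, 1) (contDiffAt_branchExp α d lam mI SNR mD
      (le_max_left 0 (T - z))) contDiffAt_fst).mul (ContDiffAt.comp (1, 1)
        (contDiffAt_branchExp α d lam mI SNR mD hz.le) contDiffAt_snd)
  set I : Fin 2 → Ω → ℝ≥0∞ := fun n ω => interference α d (fun i => X n i ω) (fun i => h n i ω)
    with hI
  set Y : Fin 2 → Ω → ℝ := fun n ω => (I n ω).toReal + SNR⁻¹ with hY
  have hIm : ∀ n, Measurable (I n) := fun n =>
    measurable_interference (hmodel.poisson n).measurable (hmodel.measurable_h n)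
  have hYm : ∀ n, Measurable (Y n) := fun n => by fun_prop
  have hYpos : ∀ n ω, 0 < Y n ω := fun n ω => by positivity
  have hfield := fun n => interference_finite_and_integral_exp hα hd hlam.le hmI (hmodel.poisson n)
    (hmodel.measurable_h n) (hmodel.law_h n) (hmodel.indep_h n) (hmodel.indep_X_h n)
  -- Both antennas have the same transform, so a single function serves for density and tail.
  have hB : ∀ n a t, 0 ≤ a → 0 < t → branchExp α d lam mI SNR mD a t =
      ∫ ω, Real.exp (-(mD * a * t * Y n ω)) ∂μ := by
    intro n a t ha ht
    rw [branchExp_eq hmI ha ht, ← (hfield n).2 _ (by positivity), ← integral_const_mul]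
    refine integral_congr_ae (ae_of_all _ fun ω => ?_)
    simp only [hY, ← Real.exp_add]
    congr 1
    ring
  have hYind : IndepFun (Y 0) (Y 1) μ :=
    (hmodel.indep_I (by decide : (0 : Fin 2) ≠ 1)).comp
      (by fun_prop : Measurable fun x : ℝ≥0∞ => x.toReal + SNR⁻¹)
      (by fun_prop : Measurable fun x : ℝ≥0∞ => x.toReal + SNR⁻¹)
  have hYg : IndepFun (fun ω => (Y 0 ω, Y 1 ω)) (fun ω => (g 1 ω, g 0 ω)) μ := by
    have hm : ∀ n, Measurable fun p : (Fin 2 → ℕ → Plane) × (Fin 2 → ℕ → ℝ) =>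
        (interference α d (p.1 n) (p.2 n)).toReal + SNR⁻¹ := fun n => by
      have := measurable_interference (Ω := (Fin 2 → ℕ → Plane) × (Fin 2 → ℕ → ℝ)) (α := α)
        (d := d) (X := fun i p => p.1 n i) (h := fun i p => p.2 n i) (fun i => by fun_prop)
        (fun i => by fun_prop)
      exact this.ennreal_toReal.add_const _
    exact hmodel.indep_g_field.symm.comp ((hm 0).prodMk (hm 1))
      (by fun_prop : Measurable fun x : Fin 2 → ℝ => (x 1, x 0))
  obtain ⟨hint, hprob⟩ := measureReal_le_div_add_div (T := T) hmD hmD0 (hmodel.measurable_g 0)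
    (hmodel.measurable_g 1) (hYm 0) (hYm 1) (hYpos 0) (hYpos 1) (hmodel.law_g 0) (hmodel.law_g 1)
    (hmodel.indep_g.indepFun (by decide)) hYind hYg (hB 0) (hB 1)
  have heq : ∀ k, mrcIntegrand mD SNR T lam (ncB α d mI T mD) k = _ := fun k =>
    funext (mrcIntegrand_ncB α d lam mI SNR T mD k)
  refine ⟨fun k hk => heq k ▸ hint k hk, ?_⟩
  simp_rw [mrcFormula, heq]
  rw [← hprob, successProbMRC]
  -- The extended and the real SINR events are compared only where gains are nonnegative and
  -- interference is finite, which is almost everywhere.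
  refine measureReal_congr ?_
  have hgnn : ∀ᵐ ω ∂μ, ∀ n, 0 ≤ g n ω := ae_all_iff.2 fun n =>
    ((hmodel.law_g n).ae_iff (p := fun x => 0 ≤ x)
      (measurableSet_Ici (a := (0 : ℝ))).mem).2 (ae_nonneg_gammaMeasure _ _)
  have hIfin : ∀ᵐ ω ∂μ, ∀ n, I n ω ≠ ∞ := ae_all_iff.2 fun n => (hfield n).1
  filter_upwards [hgnn, hIfin] with ω h1 h2
  exact propext (le_sinrMRC_two_iff hSNR h1 h2)
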